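/- Let $\mathcal A$ be a finite set and let $\mathbf Z=(Z_1,Z_2,\dots)$ be a stationary Markov chain on $\mathcal A$ whose transition probability matrix is aperiodic and irreducible (that is, some power of it has all entries strictly positive). Let $h:\mathcal A^{\mathbb N}\times\mathcal A^{\mathbb N}\to\mathbb R$ be a symmetric kernel that depends only on the first letters of its two arguments; for letters $a,b\in\mathcal A$ write $h(a,b)$ for its value on any pair of sequences beginning with $a$ and $b$, respectively. Suppose that $h$ is centered, i.e. that its Hoeffding projection $H(\mathbf z)=E\,h(\mathbf z,\mathbf Z)$ is identically zero. Put $$T_n=\sum_{i=1}^{n}\sum_{j=1}^{n}h(Z_i,Z_j).$$ Then, as $n\to\infty$, $T_n/n$ converges in distribution to a quadratic form in at most $|\mathcal A|$ independent standard normal random variables; that is, there are an integer $k\le|\mathcal A|$ and a quadratic form $q$ on $\mathbb R^k$ such that $T_n/n\Longrightarrow q(\xi_1,\dots,\xi_k)$, where $\xi_1,\dots,\xi_k$ are independent standard normal random variables. -/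

import Mathlib

open MeasureTheory ProbabilityTheory Filter

noncomputable section

/-- `Z 0, Z 1, Z 2, …` (playing the role of `Z₁, Z₂, Z₃, …`) is a stationary Markov chain, under
the probability measure `P`, with transition probability matrix `T` and stationary
distribution `p`. -/
structure IsStationaryMarkovChain {A Ω : Type*} [Fintype A] [DecidableEq A] [MeasurableSpace A]
    [MeasurableSpace Ω] (T : Matrix A A ℝ) (p : A → ℝ) (Z : ℕ → Ω → A) (P : Measure Ω) :
    Prop where
  stochastic : T ∈ Matrix.rowStochastic ℝ A
  distribution : p ∈ stdSimplex ℝ A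
  stationary : Matrix.vecMul p T = p
  measurable : ∀ i, Measurable (Z i)
  /-- The probability of the cylinder set of sequences starting with `x 0, x 1, …, x n`. -/
  cylinder : ∀ (n : ℕ) (x : ℕ → A),
    P.real {ω | ∀ i ≤ n, Z i ω = x i} = p (x 0) * ∏ i ∈ Finset.range n, T (x i) (x (i + 1))

/-- The `i`-th power of the forward shift on sequences. -/
def seqShift {A : Type*} (i : ℕ) (z : ℕ → A) : ℕ → A := fun n => z (n + i)

/-- The random sequence `ω ↦ (Z 0 ω, Z 1 ω, …)`. -/
def samplePath {A Ω : Type*} (Z : ℕ → Ω → A) (ω : Ω) : ℕ → A := fun n => Z n ω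

/-- A kernel `h` on sequences depends only on the first letters of its two arguments. -/
def DependsOnFirstLetters {A : Type*} (h : (ℕ → A) → (ℕ → A) → ℝ) : Prop :=
  ∀ x x' y y' : ℕ → A, x 0 = x' 0 → y 0 = y' 0 → h x y = h x' y'

/-- The Hoeffding projection `H(z) = E h(z, Z)` of a kernel `h`. -/
def hoeffdingProjection {A Ω : Type*} [MeasurableSpace Ω] (h : (ℕ → A) → (ℕ → A) → ℝ)
    (Z : ℕ → Ω → A) (P : Measure Ω) (z : ℕ → A) : ℝ :=
  ∫ ω, h z (samplePath Z ω) ∂P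

/-- A kernel is centered if its Hoeffding projection is identically zero. -/
def IsCenteredKernel {A Ω : Type*} [MeasurableSpace Ω] (h : (ℕ → A) → (ℕ → A) → ℝ)
    (Z : ℕ → Ω → A) (P : Measure Ω) : Prop :=
  ∀ z : ℕ → A, hoeffdingProjection h Z P z = 0

/-- The random variable `Tₙ = ∑ᵢ ∑ⱼ h`, the sum over all ordered pairs (diagonal included) of `n`
successive indices. The `i`-th argument is the path started at the `i`-th state; for a kernel
depending only on first letters the summand is the value of `h` at the letters `Z i`, `Z j`. -/
def doubleSum {A Ω : Type*} (h : (ℕ → A) → (ℕ → A) → ℝ) (Z : ℕ → Ω → A) (n : ℕ) (ω : Ω) : ℝ :=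
  ∑ i ∈ Finset.range n, ∑ j ∈ Finset.range n,
    h (seqShift i (samplePath Z ω)) (seqShift j (samplePath Z ω))

end

/-! Because the kernel sees only first letters, `T_n / n` is a quadratic form with matrix `H` in the
occupation counts divided by `√n`. Centering and symmetry give `H p = 0` and `p H = 0`, so the
counts may be centered at no cost (`doubleSum_div_eq`). If the centered counts converge to `N(0,
S)`, the law of `√S ξ`, continuous mapping gives the limit `H[√S ξ]`.

The central limit theorem is proved by characteristic functions (`exists_tendsto_charFun`). For `f`
centered these are `p · Kⁿ 1`, where `K = diag(e^{iθf}) T` and `θ = 1/√n`. No spectral theory is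
needed: two Poisson equations provide `u = 1 + iθg + θ²w` with `K u = (1 - θ²s/2) u + O(θ³)`. As `K`
is a sup-norm contraction, `n` iterations cost only `n · O(n^(-3/2))`, and `(1 - s/(2n))ⁿ →
e^(-s/2)`. -/

open scoped Matrix MatrixOrder Topology

/-! ### Primitive stochastic matrices and the Poisson equation. -/

section StochasticMatrix

variable {A : Type*} [Fintype A] [DecidableEq A] {T : Matrix A A ℝ} {p : A → ℝ}

/-- A harmonic vector of a primitive stochastic matrix is constant. -/
theorem Matrix.IsPrimitive.eq_of_mulVec_eq (hT : T.IsPrimitive)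
    (hs : T ∈ Matrix.rowStochastic ℝ A) {x : A → ℝ} (hx : T *ᵥ x = x) (a b : A) : x a = x b := by
  obtain ⟨k, -, hk⟩ := hT.exists_pos_pow
  have hpow : ∀ n : ℕ, (T ^ n) *ᵥ x = x := by
    intro n
    induction n with
    | zero => simp
    | succ n ih => rw [pow_succ, ← Matrix.mulVec_mulVec, hx, ih]
  have hsk : T ^ k ∈ Matrix.rowStochastic ℝ A := pow_mem hs k
  have : Nonempty A := ⟨a⟩
  obtain ⟨m, hm⟩ := Finite.exists_max x
  -- Maximum principle: the maximum `x m` is an average of all values of `x` with strictly positive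
  -- weights.
  have key : ∑ j, (T ^ k) m j * (x m - x j) = 0 := by
    have h1 := congrFun (hpow k) m
    simp only [Matrix.mulVec, dotProduct] at h1
    simp only [mul_sub, Finset.sum_sub_distrib, ← Finset.sum_mul]
    rw [h1, Matrix.sum_row_of_mem_rowStochastic hsk, one_mul, sub_self]
  rw [Finset.sum_eq_zero_iff_of_nonneg
    (fun j _ => mul_nonneg (hk m j).le (sub_nonneg.2 (hm j)))] at key
  have hall : ∀ j, x m = x j := fun j =>
    sub_eq_zero.1 ((mul_eq_zero.1 (key j (Finset.mem_univ j))).resolve_left (hk m j).ne')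
  rw [← hall a, ← hall b]

/-- The Poisson equation `y - T y = r` has a solution depending linearly on the right hand side
`r`, provided that `r` is centered with respect to the stationary distribution. -/
theorem exists_poisson_solution (hT : T.IsPrimitive) (hs : T ∈ Matrix.rowStochastic ℝ A)
    (hp : p ∈ stdSimplex ℝ A) (hpT : p ᵥ* T = p) :
    ∃ G : Matrix A A ℝ, ∀ r : A → ℝ, p ⬝ᵥ r = 0 → G *ᵥ r - T *ᵥ (G *ᵥ r) = r := by
  -- The rank-one term removes the constants from the kernel of `1 - T`. Since `p N = p`, a centered
  -- right-hand side has a centered solution, on which this term vanishes.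
  set N : Matrix A A ℝ := 1 - T + Matrix.vecMulVec 1 p with hN
  have hNx : ∀ x, N *ᵥ x = x - T *ᵥ x + fun _ => p ⬝ᵥ x := by
    intro x
    rw [hN, Matrix.add_mulVec, Matrix.sub_mulVec, Matrix.one_mulVec, Matrix.vecMulVec_mulVec]
    ext a
    simp
  have hpN : ∀ x, p ⬝ᵥ (N *ᵥ x) = p ⬝ᵥ x := by
    intro x
    rw [hNx, dotProduct_add, dotProduct_sub, Matrix.dotProduct_mulVec, hpT, sub_self, zero_add]
    simp only [dotProduct, ← Finset.sum_mul]
    rw [hp.2, one_mul]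
  have hsol : ∀ x, p ⬝ᵥ (N *ᵥ x) = 0 → x - T *ᵥ x = N *ᵥ x := by
    intro x hx
    rw [hpN] at hx
    rw [hNx, hx]
    ext a
    simp
  have hinj : Function.Injective N.mulVec := by
    refine (injective_iff_map_eq_zero N.mulVecLin).2 fun x hx => ?_
    rw [Matrix.mulVecLin_apply] at hx
    have h0 : p ⬝ᵥ x = 0 := by rw [← hpN, hx, dotProduct_zero]
    have hfix : T *ᵥ x = x := by
      have := hsol x (by rw [hx, dotProduct_zero])
      rw [hx] at this
      exact (sub_eq_zero.1 this).symm
    ext a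
    have : p ⬝ᵥ x = x a := by
      simp only [dotProduct, fun b => hT.eq_of_mulVec_eq hs hfix b a, ← Finset.sum_mul]
      rw [hp.2, one_mul]
    rw [← this, h0, Pi.zero_apply]
  have hunit := (Matrix.isUnit_iff_isUnit_det N).1 (Matrix.mulVec_injective_iff_isUnit.1 hinj)
  refine ⟨N⁻¹, fun r hr => ?_⟩
  have hNr : N *ᵥ (N⁻¹ *ᵥ r) = r := by
    rw [Matrix.mulVec_mulVec, Matrix.mul_nonsing_inv _ hunit, Matrix.one_mulVec]
  rw [hsol _ (by rw [hNr, hr]), hNr]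

/-- The quadratic form `x ↦ ∑ₐ pₐ (xₐ² - (T x)ₐ²)`. -/
theorem dotProduct_diagonal_sub_mulVec (x : A → ℝ) :
    x ⬝ᵥ (Matrix.diagonal p - Tᵀ * Matrix.diagonal p * T) *ᵥ x =
      p ⬝ᵥ (fun a => x a ^ 2 - (T *ᵥ x) a ^ 2) := by
  rw [Matrix.sub_mulVec, dotProduct_sub, ← Matrix.mulVec_mulVec, ← Matrix.mulVec_mulVec,
    Matrix.dotProduct_mulVec _ Tᵀ, Matrix.vecMul_transpose]
  simp only [dotProduct, Matrix.mulVec_diagonal, mul_sub, Finset.sum_sub_distrib]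
  congr 1 <;> exact Finset.sum_congr rfl fun a _ => by ring

/-- Jensen's inequality in each row gives `(T x)² ≤ T (x²)`, and stationarity gives `p · T (x²) = p
· x²`. The limiting covariance inherits its positivity from this. -/
theorem posSemidef_diagonal_sub (hs : T ∈ Matrix.rowStochastic ℝ A)
    (hp : p ∈ stdSimplex ℝ A) (hpT : p ᵥ* T = p) :
    (Matrix.diagonal p - Tᵀ * Matrix.diagonal p * T).PosSemidef := by
  refine Matrix.PosSemidef.of_dotProduct_mulVec_nonneg ?_ fun x => ?_
  · rw [Matrix.IsHermitian, Matrix.conjTranspose_eq_transpose_of_trivial]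
    simp [Matrix.transpose_mul, Matrix.mul_assoc]
  · rw [star_trivial, dotProduct_diagonal_sub_mulVec]
    have hjensen : ∀ a, (T *ᵥ x) a ^ 2 ≤ (T *ᵥ (fun b => x b ^ 2)) a := by
      intro a
      have h0 : 0 ≤ ∑ b, T a b * (x b - (T *ᵥ x) a) ^ 2 := Finset.sum_nonneg fun b _ =>
        mul_nonneg (Matrix.nonneg_of_mem_rowStochastic hs) (sq_nonneg _)
      have h1 : ∑ b, T a b * (x b - (T *ᵥ x) a) ^ 2 =
          (T *ᵥ (fun b => x b ^ 2)) a - 2 * (T *ᵥ x) a * (T *ᵥ x) a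
            + (∑ b, T a b) * (T *ᵥ x) a ^ 2 := by
        generalize hc : (T *ᵥ x) a = c
        nth_rewrite 2 [← hc]
        simp only [Matrix.mulVec, dotProduct, Finset.mul_sum, Finset.sum_mul,
          ← Finset.sum_sub_distrib, ← Finset.sum_add_distrib]
        exact Finset.sum_congr rfl fun b _ => by ring
      rw [h1, Matrix.sum_row_of_mem_rowStochastic hs] at h0
      linarith
    have hst : p ⬝ᵥ (fun b => x b ^ 2) = p ⬝ᵥ (T *ᵥ fun b => x b ^ 2) := by
      rw [Matrix.dotProduct_mulVec, hpT]
    have : p ⬝ᵥ (fun a => x a ^ 2 - (T *ᵥ x) a ^ 2) =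
        p ⬝ᵥ (fun b => x b ^ 2) - p ⬝ᵥ (fun a => (T *ᵥ x) a ^ 2) := by
      rw [← dotProduct_sub]; rfl
    rw [this, hst, ← dotProduct_sub]
    exact Finset.sum_nonneg fun a _ => mul_nonneg (hp.1 a) (sub_nonneg.2 (hjensen a))

end StochasticMatrix

/-! ### Approximate eigenvectors of the twisted matrix. -/

section Perturbation

/-- Second order expansion of the approximate eigenvalue equation for `e^{iθf} T`. -/
theorem isBigO_exp_mul_sub_mul (f g w s G W : ℝ) (hg : g - G = f)
    (hw : w - W = s / 2 - f ^ 2 / 2 - f * G) :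
    (fun θ : ℝ => Complex.exp (θ * f * Complex.I) * (1 + θ * G * Complex.I + θ ^ 2 * W) -
      (1 - θ ^ 2 * s / 2) * (1 + θ * g * Complex.I + θ ^ 2 * w)) =O[𝓝 0] fun θ => θ ^ 3 := by
  have hlin : Tendsto (fun θ : ℝ => (θ * f * Complex.I : ℂ)) (𝓝 0) (𝓝 0) :=
    Continuous.tendsto' (by fun_prop) _ _ (by simp)
  have hexp : (fun θ : ℝ => Complex.exp (θ * f * Complex.I) -
      (1 + θ * f * Complex.I - θ ^ 2 * f ^ 2 / 2)) =O[𝓝 0] fun θ => θ ^ 3 := by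
    have h1 := (Complex.exp_sub_sum_range_isBigO_pow 3).comp_tendsto hlin
    have h2 : ((fun x : ℂ => x ^ 3) ∘ fun θ : ℝ => (θ * f * Complex.I : ℂ)) =O[𝓝 0]
        fun θ : ℝ => θ ^ 3 := by
      refine Asymptotics.IsBigO.of_bound (|f| ^ 3) (Eventually.of_forall fun θ => ?_)
      simp [mul_pow, mul_comm]
    refine (h1.trans h2).congr_left fun θ => ?_
    simp only [Function.comp, Finset.sum_range_succ, Finset.sum_range_zero]
    norm_num [Nat.factorial]
    linear_combination (((θ * f : ℂ) ^ 2) / 2) * Complex.I_sq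
  have hb : ∀ F : ℝ → ℂ, Continuous F → F =O[𝓝 0] fun _ => (1 : ℝ) := fun F hF =>
    (hF.tendsto 0).isBigO_one ℝ
  have h1 := hexp.mul (hb (fun θ : ℝ => 1 + θ * G * Complex.I + θ ^ 2 * W) (by fun_prop))
  have h2 : (fun θ : ℝ => (θ : ℂ) ^ 3) =O[𝓝 0] fun θ => θ ^ 3 :=
    Asymptotics.IsBigO.of_bound 1 (Eventually.of_forall fun θ => by simp)
  -- The hypotheses on `g` and `w` cancel orders one and two; these are the remaining terms of
  -- orders three and four.
  have h3 := h2.mul (hb (fun θ : ℝ => (f * W - f ^ 2 * G / 2 + s * g / 2) * Complex.I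
    + θ * (s * w / 2 - f ^ 2 * W / 2)) (by fun_prop))
  simp only [mul_one] at h1 h3
  refine (h1.add h3).congr_left fun θ => ?_
  have hg' : (g : ℂ) = G + f := by rw [← hg]; push_cast; ring
  have hw' : (w : ℂ) = W + (s / 2 - f ^ 2 / 2 - f * G) := by
    exact_mod_cast (by linarith : w = W + (s / 2 - f ^ 2 / 2 - f * G))
  rw [hg', hw']
  linear_combination (-(θ ^ 2 * f * G) : ℂ) * Complex.I_sq

variable {A : Type*} [Fintype A]

theorem norm_mulVec_le_of_sum_norm_le_one {K : Matrix A A ℂ} (hK : ∀ a, ∑ b, ‖K a b‖ ≤ 1)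
    (v : A → ℂ) : ‖K *ᵥ v‖ ≤ ‖v‖ := by
  refine (pi_norm_le_iff_of_nonneg (norm_nonneg v)).2 fun a => ?_
  calc ‖(K *ᵥ v) a‖ ≤ ∑ b, ‖K a b * v b‖ := norm_sum_le _ _
    _ ≤ ∑ b, ‖K a b‖ * ‖v‖ := Finset.sum_le_sum fun b _ => by
        rw [norm_mul]; gcongr; exact norm_le_pi_norm v b
    _ ≤ ‖v‖ := by
        rw [← Finset.sum_mul]; exact mul_le_of_le_one_left (norm_nonneg v) (hK a)

variable [DecidableEq A]

theorem norm_pow_mulVec_le {K : Matrix A A ℂ} (hK : ∀ a, ∑ b, ‖K a b‖ ≤ 1)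
    (n : ℕ) (v : A → ℂ) : ‖(K ^ n) *ᵥ v‖ ≤ ‖v‖ := by
  induction n with
  | zero => simp
  | succ n ih =>
    rw [pow_succ', ← Matrix.mulVec_mulVec]
    exact (norm_mulVec_le_of_sum_norm_le_one hK _).trans ih

/-- Approximate eigenvectors of a contraction are approximate eigenvectors of its powers. -/
theorem norm_pow_mulVec_sub_le {K : Matrix A A ℂ} (hK : ∀ a, ∑ b, ‖K a b‖ ≤ 1) {l : ℂ}
    (hl : ‖l‖ ≤ 1) (u : A → ℂ) (n : ℕ) :
    ‖(K ^ n) *ᵥ u - l ^ n • u‖ ≤ n * ‖K *ᵥ u - l • u‖ := by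
  induction n with
  | zero => simp
  | succ n ih =>
    have : (K ^ (n + 1)) *ᵥ u - l ^ (n + 1) • u =
        (K ^ n) *ᵥ (K *ᵥ u - l • u) + l • ((K ^ n) *ᵥ u - l ^ n • u) := by
      rw [Matrix.mulVec_sub, Matrix.mulVec_smul, Matrix.mulVec_mulVec, ← pow_succ, smul_sub,
        smul_smul, ← pow_succ']
      abel
    rw [this]
    refine (norm_add_le _ _).trans ?_
    rw [norm_smul]
    have h1 := norm_pow_mulVec_le hK n (K *ᵥ u - l • u)
    have h2 : ‖l‖ * ‖(K ^ n) *ᵥ u - l ^ n • u‖ ≤ ‖(K ^ n) *ᵥ u - l ^ n • u‖ :=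
      mul_le_of_le_one_left (norm_nonneg _) hl
    push_cast
    linarith

/-- The stochastic matrix `T` with its `a`-th row multiplied by `e^{iθf(a)}`. -/
noncomputable def twistedMatrix (T : Matrix A A ℝ) (f : A → ℝ) (θ : ℝ) : Matrix A A ℂ :=
  Matrix.of fun a b => Complex.exp (θ * f a * Complex.I) * T a b

theorem sum_norm_twistedMatrix {T : Matrix A A ℝ} (hs : T ∈ Matrix.rowStochastic ℝ A)
    (f : A → ℝ) (θ : ℝ) (a : A) : ∑ b, ‖twistedMatrix T f θ a b‖ = 1 := by
  rw [← Matrix.sum_row_of_mem_rowStochastic hs a]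
  refine Finset.sum_congr rfl fun b _ => ?_
  rw [twistedMatrix, Matrix.of_apply, norm_mul, ← Complex.ofReal_mul,
    Complex.norm_exp_ofReal_mul_I, one_mul, Complex.norm_real, Real.norm_of_nonneg
    (Matrix.nonneg_of_mem_rowStochastic hs)]

theorem twistedMatrix_mulVec {T : Matrix A A ℝ} (hs : T ∈ Matrix.rowStochastic ℝ A)
    (f g w : A → ℝ) (θ : ℝ) (a : A) :
    (twistedMatrix T f θ *ᵥ fun b => 1 + θ * g b * Complex.I + θ ^ 2 * w b) a =
      Complex.exp (θ * f a * Complex.I) *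
        (1 + θ * ((T *ᵥ g) a : ℝ) * Complex.I + θ ^ 2 * ((T *ᵥ w) a : ℝ)) := by
  have h1 : (1 : ℂ) = ∑ b, (T a b : ℂ) := by
    exact_mod_cast (Matrix.sum_row_of_mem_rowStochastic hs a).symm
  rw [h1]
  simp only [twistedMatrix, Matrix.mulVec, dotProduct, Matrix.of_apply, Complex.ofReal_sum,
    Finset.mul_sum, Finset.sum_mul, ← Finset.sum_add_distrib, Complex.ofReal_mul]
  rw [← h1]
  exact Finset.sum_congr rfl fun b _ => by ring

/-- The central limit theorem for the twisted powers of a stochastic matrix. -/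
theorem tendsto_pow_twistedMatrix_mulVec {T : Matrix A A ℝ} (hs : T ∈ Matrix.rowStochastic ℝ A)
    {f g w : A → ℝ} {s : ℝ} (hs0 : 0 ≤ s) (hg : g - T *ᵥ g = f)
    (hw : w - T *ᵥ w = fun a => s / 2 - f a ^ 2 / 2 - f a * (T *ᵥ g) a) (a : A) :
    Tendsto (fun n : ℕ => ((twistedMatrix T f (√n)⁻¹ ^ n) *ᵥ fun _ => 1) a) atTop
      (𝓝 (Complex.exp (-(s / 2 : ℝ)))) := by
  set θ : ℕ → ℝ := fun n => (√n)⁻¹ with hθ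
  have hθ0 : Tendsto θ atTop (𝓝 0) :=
    tendsto_inv_atTop_zero.comp (Real.tendsto_sqrt_atTop.comp tendsto_natCast_atTop_atTop)
  set u : ℝ → A → ℂ := fun t b => 1 + t * g b * Complex.I + t ^ 2 * w b with hu
  set l : ℕ → ℂ := fun n => 1 - (θ n : ℂ) ^ 2 * s / 2 with hl
  have hK : ∀ n a, ∑ b, ‖twistedMatrix T f (θ n) a b‖ ≤ 1 := fun n a =>
    (sum_norm_twistedMatrix hs f _ a).le
  -- This includes `n = 0`, where both sides are `0` by the convention for inverses.
  have hsq : ∀ n : ℕ, θ n ^ 2 = (n : ℝ)⁻¹ := fun n => by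
    rw [hθ]; simp only [inv_pow, Real.sq_sqrt (Nat.cast_nonneg n)]
  have hul : Tendsto (fun n => u (θ n)) atTop (𝓝 fun _ => 1) := by
    have : Continuous u := by rw [hu]; fun_prop
    have h0 : u 0 = fun _ => 1 := by ext; simp [hu]
    rw [← h0]
    exact (this.tendsto 0).comp hθ0
  have hdefect : Tendsto (fun n : ℕ =>
      (n : ℝ) * ‖twistedMatrix T f (θ n) *ᵥ u (θ n) - l n • u (θ n)‖) atTop (𝓝 0) := by
    have hO : (fun n => twistedMatrix T f (θ n) *ᵥ u (θ n) - l n • u (θ n)) =O[atTop]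
        fun n => θ n ^ 3 := by
      refine Asymptotics.isBigO_pi.2 fun b => ?_
      have := (isBigO_exp_mul_sub_mul (f b) (g b) (w b) s ((T *ᵥ g) b) ((T *ᵥ w) b)
        (congrFun hg b) (congrFun hw b)).comp_tendsto hθ0
      refine this.congr_left fun n => ?_
      simp only [Function.comp, Pi.sub_apply, Pi.smul_apply, smul_eq_mul, hu, hl,
        twistedMatrix_mulVec hs]
    have h1 : (fun n : ℕ => (n : ℝ) * ‖twistedMatrix T f (θ n) *ᵥ u (θ n) - l n • u (θ n)‖)
        =O[atTop] fun n : ℕ => (n : ℝ) * θ n ^ 3 :=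
      (Asymptotics.isBigO_refl _ _).mul hO.norm_left
    refine h1.trans_tendsto (hθ0.congr' ?_)
    filter_upwards [eventually_ne_atTop 0] with n hn
    rw [pow_succ, hsq, ← mul_assoc, mul_inv_cancel₀ (Nat.cast_ne_zero.2 hn), one_mul]
  -- Only eventually: for small `n` a large `s` can push `l n` below `-1`.
  have hl1 : ∀ᶠ n in atTop, ‖l n‖ ≤ 1 := by
    have h2 : Tendsto (fun n => θ n ^ 2 * s / 2) atTop (𝓝 0) := by
      simpa using ((hθ0.pow 2).mul_const s).div_const 2
    filter_upwards [h2.eventually (ge_mem_nhds one_pos)] with n hn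
    have : l n = ((1 - θ n ^ 2 * s / 2 : ℝ) : ℂ) := by simp [hl]
    rw [this, Complex.norm_real, Real.norm_eq_abs, abs_le]
    have : 0 ≤ θ n ^ 2 * s / 2 := by positivity
    constructor <;> linarith
  have hlpow : Tendsto (fun n => l n ^ n) atTop (𝓝 (Complex.exp (-(s / 2 : ℝ)))) := by
    refine (Complex.tendsto_one_add_div_pow_exp (-(s / 2 : ℝ))).congr fun n => ?_
    have : (θ n : ℂ) ^ 2 = (n : ℂ)⁻¹ := by rw [← Complex.ofReal_pow, hsq, Complex.ofReal_inv, Complex.ofReal_natCast]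
    simp only [hl, this]
    congr 1
    push_cast
    ring
  have hmain : Tendsto (fun n => l n ^ n • u (θ n)) atTop
      (𝓝 (Complex.exp (-(s / 2 : ℝ)) • fun _ => 1)) := hlpow.smul hul
  have hd1 : Tendsto (fun n => (twistedMatrix T f (θ n) ^ n) *ᵥ u (θ n) - l n ^ n • u (θ n)) atTop
      (𝓝 0) := by
    refine squeeze_zero_norm' ?_ hdefect
    filter_upwards [hl1] with n hn
    exact norm_pow_mulVec_sub_le (hK n) hn _ n
  -- Contractivity allows the constant vector `1` to be replaced by `u (θ n)`, uniformly in the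
  -- power.
  have hd2 : Tendsto (fun n => (twistedMatrix T f (θ n) ^ n) *ᵥ ((fun _ => 1) - u (θ n))) atTop
      (𝓝 0) := by
    refine squeeze_zero_norm (fun n => norm_pow_mulVec_le (hK n) n _) ?_
    simpa using (hul.const_sub (fun _ => 1)).norm
  have hsum := (hd2.add hd1).add hmain
  have := (tendsto_pi_nhds.1 hsum) a
  simp only [Matrix.mulVec_sub, sub_add_sub_cancel, sub_add_cancel] at this
  simpa using this

end Perturbation

/-! ### Occupation counts of the chain and their central limit theorem. -/

section MarkovChain

/-- Sums over paths of products along the edges are matrix powers. -/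
theorem sum_path_prod_eq_dotProduct_pow {A R : Type*} [Fintype A] [DecidableEq A] [CommRing R]
    (K : Matrix A A R) (n : ℕ) (v : A → R) :
    ∑ x : Fin (n + 1) → A, v (x 0) * ∏ i : Fin n, K (x i.castSucc) (x i.succ) =
      v ⬝ᵥ ((K ^ n) *ᵥ fun _ => 1) := by
  induction n generalizing v with
  | zero =>
    rw [← (Equiv.funUnique (Fin 1) A).symm.sum_comp]
    simp [dotProduct]
  | succ n ih =>
    -- Summing out the first letter turns the weight `v` into `v ᵥ* K`, which is why the induction
    -- generalizes `v`.
    rw [← (Fin.consEquiv fun _ : Fin (n + 2) => A).sum_comp, Fintype.sum_prod_type,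
      Finset.sum_comm, pow_succ', ← Matrix.mulVec_mulVec, Matrix.dotProduct_mulVec, ← ih]
    refine Finset.sum_congr rfl fun y _ => ?_
    rw [Matrix.vecMul, dotProduct, Finset.sum_mul]
    refine Finset.sum_congr rfl fun a _ => ?_
    rw [Fin.prod_univ_succ, mul_assoc]
    simp [Fin.consEquiv]

variable {A Ω : Type*} [Fintype A] [DecidableEq A] {T : Matrix A A ℝ} {p : A → ℝ} {Z : ℕ → Ω → A}

/-- The normalized vector of centered occupation counts of a chain. -/
noncomputable def normalizedOccupation (p : A → ℝ) (Z : ℕ → Ω → A) (n : ℕ) (ω : Ω) :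
    EuclideanSpace ℝ A :=
  WithLp.toLp 2 fun a => (√n)⁻¹ * ∑ i ∈ Finset.range n, ((if Z i ω = a then 1 else 0) - p a)

/-- This reduces the vector-valued limit theorem to scalar additive functionals of the chain. -/
theorem inner_normalizedOccupation (t : EuclideanSpace ℝ A) (n : ℕ) (ω : Ω) :
    inner ℝ (normalizedOccupation p Z n ω) t =
      (√n)⁻¹ * ∑ i ∈ Finset.range n, (t (Z i ω) - p ⬝ᵥ t.ofLp) := by
  simp only [normalizedOccupation, PiLp.inner_apply, RCLike.inner_apply, conj_trivial]
  simp only [Finset.mul_sum, dotProduct]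
  rw [Finset.sum_comm]
  refine Finset.sum_congr rfl fun i _ => ?_
  simp only [mul_left_comm (t.ofLp _), ← Finset.mul_sum, mul_sub, Finset.sum_sub_distrib]
  simp [mul_comm]

/-- A degenerate kernel evaluated at the occupation counts. -/
theorem doubleSum_div_eq {h : (ℕ → A) → (ℕ → A) → ℝ} (hfirst : DependsOnFirstLetters h)
    {H : Matrix A A ℝ} (hH : ∀ a b, H a b = h (fun _ => a) (fun _ => b))
    (hl : H *ᵥ p = 0) (hr : p ᵥ* H = 0) (n : ℕ) (ω : Ω) :
    doubleSum h Z n ω / n = (normalizedOccupation p Z n ω).ofLp ⬝ᵥ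
      H *ᵥ (normalizedOccupation p Z n ω).ofLp := by
  set N : A → ℝ := fun a => ∑ i ∈ Finset.range n, ((Pi.single (Z i ω) 1 : A → ℝ) a - p a) with hN
  have hocc : (normalizedOccupation p Z n ω).ofLp = (√n)⁻¹ • N := by
    ext a
    simp [normalizedOccupation, hN, Pi.single_apply, eq_comm]
  have hN' : N = ∑ i ∈ Finset.range n, (Pi.single (Z i ω) 1 - p) := by
    ext a
    simp [hN]
  have hsum : N ⬝ᵥ H *ᵥ N = doubleSum h Z n ω := by
    rw [hN', Matrix.mulVec_sum, sum_dotProduct, doubleSum]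
    refine Finset.sum_congr rfl fun i _ => ?_
    rw [dotProduct_sum]
    refine Finset.sum_congr rfl fun j _ => ?_
    -- Every term containing `p` is killed by `hl` or `hr`.
    rw [Matrix.mulVec_sub, hl, sub_zero, sub_dotProduct, Matrix.dotProduct_mulVec p, hr,
      zero_dotProduct, sub_zero, Matrix.mulVec_single_one, single_one_dotProduct, Matrix.col_apply,
      hH]
    exact hfirst _ _ _ _ (by simp [seqShift, samplePath]) (by simp [seqShift, samplePath])
  rw [hocc, Matrix.mulVec_smul, dotProduct_smul, smul_dotProduct, hsum, smul_smul, smul_eq_mul,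
    ← mul_inv, Real.mul_self_sqrt (Nat.cast_nonneg n), div_eq_inv_mul]

variable [MeasurableSpace A] [DiscreteMeasurableSpace A] [MeasurableSpace Ω] {P : Measure Ω}

theorem IsStationaryMarkovChain.measurable_normalizedOccupation
    (hZ : IsStationaryMarkovChain T p Z P) (n : ℕ) : Measurable (normalizedOccupation p Z n) := by
  refine (WithLp.measurable_toLp 2 _).comp (measurable_pi_lambda _ fun a => ?_)
  refine (Finset.measurable_fun_sum _ fun i _ => ?_).const_mul _
  exact (measurable_of_finite fun b : A => (if b = a then (1 : ℝ) else 0) - p a).comp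
    (hZ.measurable i)

variable [IsProbabilityMeasure P]

theorem IsStationaryMarkovChain.integral_apply_zero (hZ : IsStationaryMarkovChain T p Z P)
    (φ : A → ℝ) : ∫ ω, φ (Z 0 ω) ∂P = p ⬝ᵥ φ := by
  have : IsProbabilityMeasure (P.map (Z 0)) :=
    Measure.isProbabilityMeasure_map (hZ.measurable 0).aemeasurable
  rw [← integral_map (φ := Z 0) (hZ.measurable 0).aemeasurable
    (by exact (measurable_of_finite φ).aestronglyMeasurable),
    integral_fintype .of_finite]
  refine Finset.sum_congr rfl fun a _ => ?_
  rw [map_measureReal_apply (hZ.measurable 0) (measurableSet_singleton a), smul_eq_mul]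
  have := hZ.cylinder 0 fun _ => a
  simp only [Finset.range_zero, Finset.prod_empty, mul_one, Nat.le_zero, forall_eq] at this
  rw [← this]
  rfl

/-- The characteristic function of an additive functional of the chain. -/
theorem IsStationaryMarkovChain.integral_exp_sum (hZ : IsStationaryMarkovChain T p Z P)
    (f : A → ℝ) (θ : ℝ) (n : ℕ) :
    ∫ ω, Complex.exp (((θ * ∑ i ∈ Finset.range n, f (Z i ω) : ℝ) : ℂ) * Complex.I) ∂P =
      ∑ a, (p a : ℂ) * ((twistedMatrix T f θ ^ n) *ᵥ fun _ => 1) a := by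
  -- The sum has `n` terms but the path `n + 1` letters: each phase sits at the source of an edge,
  -- so the last letter carries none.
  set Y : Ω → Fin (n + 1) → A := fun ω i => Z i ω with hY
  have hYm : Measurable Y := measurable_pi_lambda _ fun i => hZ.measurable i
  set F : (Fin (n + 1) → A) → ℂ := fun x =>
    ∏ i : Fin n, Complex.exp (θ * f (x i.castSucc) * Complex.I) with hF
  have : IsProbabilityMeasure (P.map Y) := Measure.isProbabilityMeasure_map hYm.aemeasurable
  have h1 : ∀ ω, Complex.exp (((θ * ∑ i ∈ Finset.range n, f (Z i ω) : ℝ) : ℂ) * Complex.I) =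
      F (Y ω) := by
    intro ω
    simp only [hF, hY, Fin.val_castSucc]
    rw [← Complex.exp_sum, ← Fin.sum_univ_eq_sum_range (fun i => f (Z i ω)) n]
    push_cast
    rw [Finset.mul_sum, Finset.sum_mul]
  simp only [h1]
  rw [← integral_map (φ := Y) hYm.aemeasurable
    (by exact (measurable_of_finite F).aestronglyMeasurable), integral_fintype .of_finite]
  have h2 := sum_path_prod_eq_dotProduct_pow (twistedMatrix T f θ) n fun a => (p a : ℂ)
  rw [dotProduct] at h2
  rw [← h2]
  refine Finset.sum_congr rfl fun x _ => ?_
  have h3 : (P.map Y).real {x} = p (x 0) * ∏ i : Fin n, T (x i.castSucc) (x i.succ) := by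
    rw [map_measureReal_apply hYm (measurableSet_singleton x)]
    -- `Fin.ofNat` extends `x` periodically to `ℕ`; only indices up to `n` matter.
    have hc := hZ.cylinder n fun i => x (Fin.ofNat (n + 1) i)
    have hset : Y ⁻¹' {x} = {ω | ∀ i ≤ n, Z i ω = x (Fin.ofNat (n + 1) i)} := by
      ext ω
      simp only [Set.mem_preimage, Set.mem_singleton_iff, Set.mem_ofPred_eq, funext_iff, hY]
      constructor
      · intro h i hi
        rw [← h]
        simp [Nat.mod_eq_of_lt (Nat.lt_succ_of_le hi)]
      · intro h i
        rw [h i (Nat.le_of_lt_succ i.2)]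
        congr 1
        ext
        simp
    rw [hset, hc, ← Fin.prod_univ_eq_prod_range
      (fun i => T (x (Fin.ofNat (n + 1) i)) (x (Fin.ofNat (n + 1) (i + 1)))) n]
    congr 1
    refine Finset.prod_congr rfl fun i _ => ?_
    congr 2
    · ext; simp
    · ext; simp [Nat.mod_eq_of_lt (Nat.succ_lt_succ i.2)]
  rw [h3, Complex.real_smul, hF]
  simp only [twistedMatrix, Matrix.of_apply, Finset.prod_mul_distrib]
  push_cast
  ring

/-- The multivariate central limit theorem for the occupation counts of a finite Markov chain. -/
theorem IsStationaryMarkovChain.exists_tendsto_charFun (hZ : IsStationaryMarkovChain T p Z P)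
    (hT : T.IsPrimitive) : ∃ S : Matrix A A ℝ, S.PosSemidef ∧ ∀ t : EuclideanSpace ℝ A,
      Tendsto (fun n => charFun (P.map (normalizedOccupation p Z n)) t) atTop
        (𝓝 (charFun (multivariateGaussian 0 S) t)) := by
  have hs := hZ.stochastic
  have hp := hZ.distribution
  have hpT := hZ.stationary
  obtain ⟨G, hG⟩ := exists_poisson_solution hT hs hp hpT
  set M := Matrix.diagonal p - Tᵀ * Matrix.diagonal p * T with hM
  have hMpos : M.PosSemidef := posSemidef_diagonal_sub hs hp hpT
  -- `L` centers `t` and then solves the Poisson equation, so `g = L t` and the variance `s` is a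
  -- quadratic form in `t`.
  set L : Matrix A A ℝ := G * (1 - Matrix.vecMulVec 1 p) with hL
  have hS : (Lᵀ * M * L).PosSemidef := by
    rw [← Matrix.conjTranspose_eq_transpose_of_trivial]
    exact hMpos.conjTranspose_mul_mul_same L
  refine ⟨Lᵀ * M * L, hS, fun t => ?_⟩
  set f : A → ℝ := fun a => t a - p ⬝ᵥ t.ofLp with hf
  have hLt : L *ᵥ t.ofLp = G *ᵥ f := by
    rw [hL, ← Matrix.mulVec_mulVec, Matrix.sub_mulVec, Matrix.one_mulVec, Matrix.vecMulVec_mulVec]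
    congr 1
    ext a
    simp [hf]
  have hpf : p ⬝ᵥ f = 0 := by
    have : p ⬝ᵥ f = p ⬝ᵥ t.ofLp - (∑ a, p a) * (p ⬝ᵥ t.ofLp) := by
      rw [Finset.sum_mul, dotProduct, dotProduct, ← Finset.sum_sub_distrib]
      exact Finset.sum_congr rfl fun a _ => mul_sub _ _ _
    rw [this, hp.2, one_mul, sub_self]
  set g := G *ᵥ f with hg
  set s := p ⬝ᵥ (fun a => g a ^ 2 - (T *ᵥ g) a ^ 2) with hsdef
  have hquad : t.ofLp ⬝ᵥ (Lᵀ * M * L) *ᵥ t.ofLp = s := by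
    rw [← Matrix.mulVec_mulVec, ← Matrix.mulVec_mulVec, Matrix.dotProduct_mulVec,
      Matrix.vecMul_transpose, hLt, hM, dotProduct_diagonal_sub_mulVec]
  have hs0 : 0 ≤ s := by
    rw [← hquad]
    simpa using hS.dotProduct_mulVec_nonneg t.ofLp
  have hgf : g - T *ᵥ g = f := hG f hpf
  set r : A → ℝ := fun a => s / 2 - f a ^ 2 / 2 - f a * (T *ᵥ g) a with hr
  -- Solvability of the second Poisson equation dictates `s`: since `f = g - T g`, one has `f² + 2 f
  -- (T g) = g² - (T g)²`.
  have hpr : p ⬝ᵥ r = 0 := by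
    have h1 : ∀ a, r a = s / 2 - (g a ^ 2 - (T *ᵥ g) a ^ 2) / 2 := fun a => by
      rw [hr]
      simp only [← hgf, Pi.sub_apply]
      ring
    have h2 : p ⬝ᵥ r = (∑ a, p a) * (s / 2) - s / 2 := by
      rw [Finset.sum_mul]
      nth_rewrite 2 [hsdef]
      rw [dotProduct, dotProduct, Finset.sum_div, ← Finset.sum_sub_distrib]
      exact Finset.sum_congr rfl fun a _ => by rw [h1]; ring
    rw [h2, hp.2, one_mul, sub_self]
  have hlim : charFun (multivariateGaussian 0 (Lᵀ * M * L)) t =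
      ∑ a, (p a : ℂ) * Complex.exp (-(s / 2 : ℝ)) := by
    rw [charFun_multivariateGaussian hS, hquad, ← Finset.sum_mul, ← Complex.ofReal_sum, hp.2]
    simp
  rw [hlim]
  refine (tendsto_finsetSum _ fun a _ => (tendsto_pow_twistedMatrix_mulVec hs hs0 hgf
    (hG r hpr) a).const_mul (p a : ℂ)).congr fun n => ?_
  rw [← hZ.integral_exp_sum, charFun_apply,
    integral_map (hZ.measurable_normalizedOccupation n).aemeasurable (by fun_prop)]
  simp only [inner_normalizedOccupation, hf]

end MarkovChain

/-! ### Weak convergence of the normalized double sum. -/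

theorem mainTheorem7 {A Ω : Type*} [Fintype A] [DecidableEq A] [MeasurableSpace A]
    [DiscreteMeasurableSpace A] [MeasurableSpace Ω] (P : Measure Ω) [IsProbabilityMeasure P]
    (T : Matrix A A ℝ) (p : A → ℝ) (Z : ℕ → Ω → A)
    (hZ : IsStationaryMarkovChain T p Z P) (hT : T.IsPrimitive)
    (h : (ℕ → A) → (ℕ → A) → ℝ) (hsymm : ∀ x y, h x y = h y x)
    (hfirst : DependsOnFirstLetters h) (hcentered : IsCenteredKernel h Z P) :
    ∃ k ≤ Fintype.card A, ∃ q : QuadraticForm ℝ (Fin k → ℝ),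
      TendstoInDistribution (fun (n : ℕ) (ω : Ω) => doubleSum h Z n ω / (n : ℝ)) atTop
        (fun x : Fin k → ℝ => q x) (fun _ => P)
        (Measure.pi fun _ : Fin k => gaussianReal 0 1) := by
  set H : Matrix A A ℝ := Matrix.of fun a b => h (fun _ => a) (fun _ => b) with hH
  have hl : H *ᵥ p = 0 := by
    ext a
    rw [Pi.zero_apply, ← hcentered fun _ => a, hoeffdingProjection, Matrix.mulVec, dotProduct_comm,
      ← hZ.integral_apply_zero]
    exact integral_congr_ae (Eventually.of_forall fun ω => hfirst _ _ _ _ rfl rfl)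
  have hHt : Hᵀ = H := by
    ext a b
    exact hsymm _ _
  have hr : p ᵥ* H = 0 := by rw [← Matrix.mulVec_transpose, hHt, hl]
  obtain ⟨S, hS, hlim⟩ := hZ.exists_tendsto_charFun hT
  set e := Fintype.equivFin A
  -- After relabelling coordinates by letters, `√S` sends a standard Gaussian vector to one with
  -- covariance `S`.
  set B : (Fin (Fintype.card A) → ℝ) →ₗ[ℝ] (A → ℝ) :=
    (CFC.sqrt S).mulVecLin ∘ₗ LinearMap.funLeft ℝ ℝ e with hB
  set X : (Fin (Fintype.card A) → ℝ) → EuclideanSpace ℝ A := fun x => WithLp.toLp 2 (B x) with hX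
  have hXc : Continuous X :=
    (PiLp.continuous_toLp 2 _).comp (LinearMap.continuous_of_finiteDimensional B)
  have hXlaw : (Measure.pi fun _ : Fin (Fintype.card A) => gaussianReal 0 1).map X =
      multivariateGaussian 0 S := by
    have h1 := (measurePreserving_piCongrLeft (fun _ : A => gaussianReal 0 1) e.symm).map_eq
    rw [multivariateGaussian, ← map_pi_eq_stdGaussian, ← h1, Measure.map_map (by fun_prop)
      (by fun_prop), Measure.map_map (by fun_prop) (by fun_prop)]
    congr 1
    ext x a
    simp [hX, hB, Matrix.mulVec, dotProduct, LinearMap.funLeft, MeasurableEquiv.piCongrLeft]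
    refine Finset.sum_congr rfl fun b _ => ?_
    obtain ⟨c, rfl⟩ := e.symm.surjective b
    rw [Equiv.piCongrLeft_apply_apply, e.apply_symm_apply]
  have hconv : TendstoInDistribution (normalizedOccupation p Z) atTop X (fun _ => P)
      (Measure.pi fun _ : Fin (Fintype.card A) => gaussianReal 0 1) := by
    refine ⟨fun n => (hZ.measurable_normalizedOccupation n).aemeasurable,
      hXc.measurable.aemeasurable, ?_⟩
    refine ProbabilityMeasure.tendsto_iff_tendsto_charFun.2 fun t => ?_
    simp only [ProbabilityMeasure.coe_mk, hXlaw]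
    exact hlim t
  -- Taking `k = |A|` works even for singular `S`, since `q` may be degenerate.
  refine ⟨_, le_rfl, H.toQuadraticForm'.comp B, ?_⟩
  have hqc : Continuous fun v : EuclideanSpace ℝ A => v.ofLp ⬝ᵥ H *ᵥ v.ofLp := by
    simp only [dotProduct, Matrix.mulVec]
    fun_prop
  have := hconv.continuous_comp hqc
  refine this.congr (fun n => Eventually.of_forall fun ω => ?_) (Eventually.of_forall fun x => ?_)
  · exact (doubleSum_div_eq hfirst (fun _ _ => rfl) hl hr n ω).symm
  · simp [Matrix.toQuadraticForm', hX, Matrix.toLinearMap₂'_apply']
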